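/- Let $k$ be an arbitrary field and let $M,N\ge 2$ be integers. Let $$\Gamma_{M,N}=\langle g_0,\dots,g_{M-1}\mid g_0^N=\dots=g_{M-1}^N=1,\ [g_{i_1}\cdots g_{i_N},\,g_{j_1}\cdots g_{j_N}]=1\rangle,$$ where the commutator relations run over all indices $i_1,\dots,i_N,j_1,\dots,j_N\in\{0,\dots,M-1\}$, and let the cyclic group $\mathbb Z_M=\langle h\rangle$ act on $\Gamma_{M,N}$ by automorphisms through $h\cdot g_i=g_{i+1}$ (indices modulo $M$). For a finite group $H$ acting by automorphisms on a group $\Gamma$, let $k[\Gamma]\rtimes k^H$ denote the smash coproduct Hopf algebra: it is $k[\Gamma]\otimes k^H$ as an algebra, where $k[\Gamma]$ is the group algebra and $k^H$ is the algebra of $k$-valued functions on $H$, and, writing $r\#\delta_x=r\otimes\delta_x$, its comultiplication, counit and antipode are given for $r\in\Gamma$, $x\in H$ by $$\Delta(r\#\delta_x)=\sum_{l\in H}(r\#\delta_l)\otimes(l^{-1}\cdot r\,\#\,\delta_{l^{-1}x}),\qquad \varepsilon(r\#\delta_x)=\delta_{x,1},\qquad S(r\#\delta_x)=x^{-1}\cdot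 r^{-1}\,\#\,\delta_{x^{-1}}.$$ Assume that one of the following conditions holds: 1. $N=2$ and $M$ is prime; 2. $M=2$ and $N$ is prime. Let $A$ be a Hopf algebra over $k$ that is infinite-dimensional and not cocommutative, and let $f:k[\Gamma_{M,N}]\rtimes k^{\mathbb Z_M}\to A$ be a surjective Hopf algebra map. Then $f$ is an isomorphism of Hopf algebras. -/

import Mathlib

open scoped TensorProduct commutatorElement

noncomputable section

/-! ### The smash coproduct `k[Γ] ⋊ k^H` -/

/-- The underlying algebra of the smash coproduct `k[Γ] ⋊ k^H`: the tensor product algebra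
`k[Γ] ⊗ k^H`, where `k^H` is the algebra of functions on `H` with pointwise operations.
A type synonym, since its coalgebra structure is not the tensor product one. -/
def SmashCoproduct (k Γ H : Type*) [Field k] [Group Γ] : Type _ :=
  MonoidAlgebra k Γ ⊗[k] (H → k)

namespace SmashCoproduct

section Algebra

variable (k Γ H : Type*) [Field k] [Group Γ]

instance instRing : Ring (SmashCoproduct k Γ H) :=
  inferInstanceAs (Ring (MonoidAlgebra k Γ ⊗[k] (H → k)))

instance instAlgebra : Algebra k (SmashCoproduct k Γ H) :=
  inferInstanceAs (Algebra k (MonoidAlgebra k Γ ⊗[k] (H → k)))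

variable {Γ H} [DecidableEq H]

/-- The element `r # δ_h = r ⊗ δ_h` of `k[Γ] ⋊ k^H`. -/
def elt (r : Γ) (h : H) : SmashCoproduct k Γ H :=
  (MonoidAlgebra.single r (1 : k) ⊗ₜ[k] (Pi.single h (1 : k) : H → k) :
    MonoidAlgebra k Γ ⊗[k] (H → k))

variable (Γ H) [Fintype H]

/-- The basis `(r # δ_h)` of `k[Γ] ⋊ k^H`. -/
def basis : Module.Basis (Γ × H) k (SmashCoproduct k Γ H) :=
  Module.Basis.tensorProduct (Module.Basis.ofRepr (MonoidAlgebra.coeffLinearEquiv k))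
    (Pi.basisFun k H)

variable {Γ H}

@[simp]
theorem basis_apply (p : Γ × H) : basis k Γ H p = elt k p.1 p.2 := by
  unfold basis elt
  erw [Module.Basis.tensorProduct_apply]
  simp
  rfl

theorem elt_mul_elt (r s : Γ) (h l : H) :
    elt k r h * elt k s l = if h = l then elt k (r * s) h else 0 := by
  have key : elt k r h * elt k s l = ((MonoidAlgebra.single (r * s) (1 : k)) ⊗ₜ[k]
      ((Pi.single h (1 : k) : H → k) * Pi.single l 1) : MonoidAlgebra k Γ ⊗[k] (H → k)) := by
    have h1 := Algebra.TensorProduct.tmul_mul_tmul (R := k) (MonoidAlgebra.single r (1 : k))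
      (MonoidAlgebra.single s (1 : k)) (Pi.single h (1 : k) : H → k) (Pi.single l (1 : k))
    rw [MonoidAlgebra.single_mul_single, one_mul] at h1
    exact h1
  rw [key]
  by_cases e : h = l
  · subst e
    rw [if_pos rfl, ← Pi.single_mul, one_mul]
    rfl
  · have : (Pi.single h (1 : k) : H → k) * Pi.single l 1 = 0 := by
      ext x
      by_cases hx : x = h
      · subst hx
        simp [e]
      · simp [hx]
    rw [if_neg e, this, TensorProduct.tmul_zero]
    rfl

theorem one_eq_sum : (1 : SmashCoproduct k Γ H) = ∑ h : H, elt k (1 : Γ) h := by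
  have h1 : (1 : H → k) = ∑ h : H, Pi.single h (1 : k) := by
    rw [Finset.univ_sum_single (fun _ : H => (1 : k))]
    rfl
  change (1 : MonoidAlgebra k Γ) ⊗ₜ[k] (1 : H → k) = _
  rw [h1, TensorProduct.tmul_sum]
  rfl

end Algebra

section Hopf

variable (k Γ H : Type*) [Field k] [Group Γ] [Group H] [Fintype H] [DecidableEq H]

/-- The counit `ε(r # δ_h) = δ_{h,1}`. -/
def counitMap : SmashCoproduct k Γ H →ₗ[k] k :=
  (basis k Γ H).constr k fun p => if p.2 = 1 then 1 else 0

variable {Γ H} in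
@[simp]
theorem counitMap_elt (r : Γ) (h : H) :
    counitMap k Γ H (elt k r h) = if h = 1 then 1 else 0 := by
  rw [← basis_apply k (r, h), counitMap, Module.Basis.constr_basis]

theorem counitMap_mul (x y : SmashCoproduct k Γ H) :
    counitMap k Γ H (x * y) = counitMap k Γ H x * counitMap k Γ H y := by
  have : (LinearMap.mul k (SmashCoproduct k Γ H)).compr₂ (counitMap k Γ H) =
      (LinearMap.mul k k).compl₁₂ (counitMap k Γ H) (counitMap k Γ H) := by
    refine (basis k Γ H).ext fun ⟨r, h⟩ => (basis k Γ H).ext fun ⟨s, l⟩ => ?_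
    simp only [basis_apply, LinearMap.compr₂_apply, LinearMap.mul_apply', elt_mul_elt,
      LinearMap.compl₁₂_apply, counitMap_elt, apply_ite (counitMap k Γ H), map_zero]
    grind
  exact LinearMap.congr_fun₂ this x y

variable [MulDistribMulAction H Γ]

/-- The comultiplication `Δ(r # δ_h) = ∑_l (r # δ_l) ⊗ (l⁻¹ • r # δ_{l⁻¹ h})`. -/
def comulMap : SmashCoproduct k Γ H →ₗ[k] SmashCoproduct k Γ H ⊗[k] SmashCoproduct k Γ H :=
  (basis k Γ H).constr k fun p => ∑ l : H, elt k p.1 l ⊗ₜ[k] elt k (l⁻¹ • p.1) (l⁻¹ * p.2)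

/-- The antipode `S(r # δ_h) = h⁻¹ • r⁻¹ # δ_{h⁻¹}`. -/
def antipodeMap : SmashCoproduct k Γ H →ₗ[k] SmashCoproduct k Γ H :=
  (basis k Γ H).constr k fun p => elt k (p.2⁻¹ • p.1⁻¹) p.2⁻¹

variable {Γ H}

@[simp]
theorem comulMap_elt (r : Γ) (h : H) : comulMap k Γ H (elt k r h) =
    ∑ l : H, elt k r l ⊗ₜ[k] elt k (l⁻¹ • r) (l⁻¹ * h) := by
  rw [← basis_apply k (r, h), comulMap, Module.Basis.constr_basis]

@[simp]
theorem antipodeMap_elt (r : Γ) (h : H) :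
    antipodeMap k Γ H (elt k r h) = elt k (h⁻¹ • r⁻¹) h⁻¹ := by
  rw [← basis_apply k (r, h), antipodeMap, Module.Basis.constr_basis]

variable (Γ H)

instance instCoalgebra : Coalgebra k (SmashCoproduct k Γ H) where
  comul := comulMap k Γ H
  counit := counitMap k Γ H
  coassoc := by
    refine (basis k Γ H).ext fun ⟨r, h⟩ => ?_
    simp only [basis_apply, LinearMap.comp_apply, comulMap_elt, map_sum,
      LinearMap.rTensor_tmul, LinearMap.lTensor_tmul, TensorProduct.sum_tmul,
      TensorProduct.tmul_sum, LinearEquiv.coe_coe, TensorProduct.assoc_tmul]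
    rw [Finset.sum_comm]
    refine Finset.sum_congr rfl fun l _ => ?_
    refine Fintype.sum_equiv (Equiv.mulLeft l⁻¹) _ _ fun m => ?_
    simp [smul_smul, mul_assoc]
  rTensor_counit_comp_comul := by
    refine (basis k Γ H).ext fun ⟨r, h⟩ => ?_
    simp [TensorProduct.ite_tmul]
  lTensor_counit_comp_comul := by
    refine (basis k Γ H).ext fun ⟨r, h⟩ => ?_
    simp [TensorProduct.tmul_ite, inv_mul_eq_one]

theorem comulMap_mul (x y : SmashCoproduct k Γ H) :
    comulMap k Γ H (x * y) = comulMap k Γ H x * comulMap k Γ H y := by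
  have : (LinearMap.mul k (SmashCoproduct k Γ H)).compr₂ (comulMap k Γ H) =
      (LinearMap.mul k (SmashCoproduct k Γ H ⊗[k] SmashCoproduct k Γ H)).compl₁₂
        (comulMap k Γ H) (comulMap k Γ H) := by
    refine (basis k Γ H).ext fun ⟨r, h⟩ => (basis k Γ H).ext fun ⟨s, l⟩ => ?_
    simp only [basis_apply, LinearMap.compr₂_apply, LinearMap.mul_apply',
      LinearMap.compl₁₂_apply, comulMap_elt, Finset.sum_mul_sum,
      Algebra.TensorProduct.tmul_mul_tmul]
    have inner : ∀ a : H,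
        ∑ b : H, (elt k r a * elt k s b) ⊗ₜ[k]
          (elt k (a⁻¹ • r) (a⁻¹ * h) * elt k (b⁻¹ • s) (b⁻¹ * l)) =
        elt k (r * s) a ⊗ₜ[k] (if h = l then elt k (a⁻¹ • (r * s)) (a⁻¹ * h) else 0) := by
      intro a
      rw [Finset.sum_eq_single a]
      · simp only [elt_mul_elt, if_true, mul_right_inj, smul_mul']
      · intro b _ hb
        rw [elt_mul_elt, if_neg (Ne.symm hb), TensorProduct.zero_tmul]
      · simp
    rw [Finset.sum_congr rfl fun a _ => inner a, elt_mul_elt]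
    by_cases e : h = l
    · simp [e]
    · simp [e]
  exact LinearMap.congr_fun₂ this x y

instance instBialgebra : Bialgebra k (SmashCoproduct k Γ H) :=
  Bialgebra.mk' k (SmashCoproduct k Γ H)
    (by
      change counitMap k Γ H 1 = 1
      simp [one_eq_sum])
    (fun {x y} => counitMap_mul k Γ H x y)
    (by
      change comulMap k Γ H 1 = 1
      rw [Algebra.TensorProduct.one_def, one_eq_sum]
      simp only [map_sum, comulMap_elt, smul_one, TensorProduct.sum_tmul, TensorProduct.tmul_sum]
      rw [Finset.sum_comm]
      conv_rhs => rw [Finset.sum_comm]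
      exact Finset.sum_congr rfl fun l _ =>
        Fintype.sum_equiv (Equiv.mulLeft l⁻¹) _ _ fun m => by simp)
    (fun {x y} => comulMap_mul k Γ H x y)

instance instHopfAlgebra : HopfAlgebra k (SmashCoproduct k Γ H) where
  antipode := antipodeMap k Γ H
  mul_antipode_rTensor_comul := by
    refine (basis k Γ H).ext fun ⟨r, h⟩ => ?_
    change LinearMap.mul' k _ ((antipodeMap k Γ H).rTensor _ (comulMap k Γ H (basis k Γ H (r, h))))
      = algebraMap k _ (counitMap k Γ H (basis k Γ H (r, h)))
    simp only [basis_apply, comulMap_elt, map_sum, LinearMap.rTensor_tmul, antipodeMap_elt,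
      LinearMap.mul'_apply, elt_mul_elt, counitMap_elt]
    by_cases e : h = 1
    · subst e
      simp only [mul_one, if_true, map_one, ← smul_mul', inv_mul_cancel, smul_one, one_eq_sum]
      exact Fintype.sum_equiv (Equiv.inv H) _ _ fun m => by simp
    · simp [e]
  mul_antipode_lTensor_comul := by
    refine (basis k Γ H).ext fun ⟨r, h⟩ => ?_
    change LinearMap.mul' k _ ((antipodeMap k Γ H).lTensor _ (comulMap k Γ H (basis k Γ H (r, h))))
      = algebraMap k _ (counitMap k Γ H (basis k Γ H (r, h)))
    simp only [basis_apply, comulMap_elt, map_sum, LinearMap.lTensor_tmul, antipodeMap_elt,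
      LinearMap.mul'_apply, elt_mul_elt, counitMap_elt]
    by_cases e : h = 1
    · subst e
      simp [one_eq_sum]
    · have e' : ∀ x : H, ¬ (x = h⁻¹ * x) := fun x hx => e (by simpa using hx)
      simp [e, e']

end Hopf

end SmashCoproduct

/-! ### The group `Γ_{M,N}` with its cyclic `ℤ/M`-action -/

/-- The relators of `Γ_{M,N}`, in the free group on `g_i`, `i ∈ ℤ/M`: the powers `g_i ^ N` and the
commutators of any two words `g_{i_1} ⋯ g_{i_N}` and `g_{j_1} ⋯ g_{j_N}`. -/
def gammaRels (M N : ℕ) : Set (FreeGroup (ZMod M)) :=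
  {w | ∃ i : ZMod M, w = FreeGroup.of i ^ N} ∪
  {w | ∃ i j : Fin N → ZMod M,
    w = ⁅(List.ofFn fun t => FreeGroup.of (i t)).prod, (List.ofFn fun t => FreeGroup.of (j t)).prod⁆}

/-- The group `Γ_{M,N}`, generated by `g_0, …, g_{M-1}` (indexed by `ℤ/M`) subject to
`g_i ^ N = 1` and `[g_{i_1} ⋯ g_{i_N}, g_{j_1} ⋯ g_{j_N}] = 1`. -/
def GammaGroup (M N : ℕ) : Type :=
  PresentedGroup (gammaRels M N)

namespace GammaGroup

variable (M N : ℕ)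

instance instGroup : Group (GammaGroup M N) :=
  inferInstanceAs (Group (PresentedGroup (gammaRels M N)))

/-- The generators `g_i` of `Γ_{M,N}`. -/
def gen (i : ZMod M) : GammaGroup M N :=
  PresentedGroup.of (rels := gammaRels M N) i

theorem lift_shift_rels (a : ZMod M) :
    ∀ w ∈ gammaRels M N, FreeGroup.lift (fun i => gen M N (i + a)) w = 1 := by
  have key : ∀ w ∈ gammaRels M N, PresentedGroup.mk (gammaRels M N) w = 1 := fun w hw =>
    PresentedGroup.one_of_mem hw
  rintro w (⟨i, rfl⟩ | ⟨i, j, rfl⟩)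
  · have := key _ (Or.inl ⟨i + a, rfl⟩)
    rw [map_pow] at this ⊢
    rwa [FreeGroup.lift_apply_of]
  · have := key _ (Or.inr ⟨fun t => i t + a, fun t => j t + a, rfl⟩)
    simp only [map_commutatorElement, map_list_prod, List.map_ofFn, Function.comp_def,
      FreeGroup.lift_apply_of] at this ⊢
    exact this

/-- The endomorphism `g_i ↦ g_{i+a}` of `Γ_{M,N}`. -/
def shift (a : ZMod M) : GammaGroup M N →* GammaGroup M N :=
  PresentedGroup.toGroup (lift_shift_rels M N a)

@[simp]
theorem shift_gen (a i : ZMod M) : shift M N a (gen M N i) = gen M N (i + a) :=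
  PresentedGroup.toGroup.of (lift_shift_rels M N a)

theorem hom_ext {G : Type*} [Group G] {φ ψ : GammaGroup M N →* G}
    (h : ∀ i, φ (gen M N i) = ψ (gen M N i)) : φ = ψ :=
  PresentedGroup.ext h

/-- The cyclic action of `ℤ/M` (written multiplicatively) on `Γ_{M,N}`: the class of `a` maps
`g_i` to `g_{i+a}`. -/
instance instMulDistribMulAction :
    MulDistribMulAction (Multiplicative (ZMod M)) (GammaGroup M N) where
  smul a x := shift M N a.toAdd x
  one_smul x := by
    change shift M N 0 x = x
    have : shift M N 0 = MonoidHom.id _ := hom_ext M N fun i => by simp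
    rw [this]
    rfl
  mul_smul a b x := by
    change shift M N (a.toAdd + b.toAdd) x = shift M N a.toAdd (shift M N b.toAdd x)
    have : shift M N (a.toAdd + b.toAdd) = (shift M N a.toAdd).comp (shift M N b.toAdd) :=
      hom_ext M N fun i => by simp [add_comm, add_left_comm]
    rw [this]
    rfl
  smul_mul a x y := map_mul (shift M N a.toAdd) x y
  smul_one a := map_one (shift M N a.toAdd)

theorem smul_gen (a : Multiplicative (ZMod M)) (i : ZMod M) :
    a • gen M N i = gen M N (i + a.toAdd) :=
  shift_gen M N a.toAdd i

end GammaGroup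

end

/-! Write e_x for the image of 1 # δ_x. Compressing the comultiplication of A by e_l ⊗ e_m gives
maps A e_{lm} → A e_l ⊗ A e_m with f(r # δ_{lm}) ↦ f(r # δ_l) ⊗ f(l⁻¹ • r # δ_m). They show that {x
| e_x ≠ 0} is a submonoid of the cyclic group of prime order M, hence trivial or everything; trivial
would make A cocommutative. So every e_x is nonzero, and Λ = {r | f(r # δ_1) = e_1} is a normal
subgroup stable under the cyclic action. If Λ = 1, the f(r # δ_1) are independent, being distinct
and group-like for the (1,1) component, and f is injective (`injective_of_trivialSubgroup_eq_bot`).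
If Λ has finite index, A is finite-dimensional, since Λ acts on each A e_x by scalars.

It remains that Λ ≠ 1 forces finite index (`finite_quotient_of_ne_bot`). The words of length N
generate a finitely generated abelian normal subgroup T with cyclic quotient. In either case T is
generated by the orbit of one τ under an endomorphism φ (the shift if N = 2, conjugation by g_0 if M
= 2), and a telescoping product shows that 1 + φ + ⋯ + φ^(p-1) kills τ, where p is the prime. So T
is a quotient of ℤ[X]/Φ_p, where every nonzero ideal contains a nonzero integer n; a φ-stable
subgroup of T other than 1 thus contains all n-th powers. If Λ is not inside T, then Γ/Λ is abelian
of exponent dividing N. -/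

/-! ### Pure tensors and group-like vectors. -/

section TensorSquare

variable {k V W : Type*} [Field k] [AddCommGroup V] [Module k V] [AddCommGroup W] [Module k W]

/-- Contraction of the second tensor factor against a linear form. -/
noncomputable def contractSnd (φ : W →ₗ[k] k) : V ⊗[k] W →ₗ[k] V :=
  (TensorProduct.rid k V).toLinearMap ∘ₗ φ.lTensor V

@[simp]
theorem contractSnd_tmul (φ : W →ₗ[k] k) (v : V) (w : W) :
    contractSnd φ (v ⊗ₜ[k] w) = φ w • v := by
  simp [contractSnd]

theorem tmul_ne_zero_of_ne_zero {v : V} {w : W} (hv : v ≠ 0) (hw : w ≠ 0) :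
    v ⊗ₜ[k] w ≠ 0 := by
  obtain ⟨φ, hφ⟩ : ∃ φ : W →ₗ[k] k, φ w ≠ 0 := by
    by_contra! h
    exact hw ((Module.forall_dual_apply_eq_zero_iff k w).1 h)
  intro h
  have := congrArg (contractSnd φ) h
  rw [contractSnd_tmul, map_zero, smul_eq_zero] at this
  exact this.elim hφ hv

/-- In an equality of nonzero pure tensors the first factors are proportional. -/
theorem exists_eq_smul_of_tmul_eq_tmul {v v' : V} {w w' : W} (hv' : v' ≠ 0) (hw' : w' ≠ 0)
    (h : v ⊗ₜ[k] w = v' ⊗ₜ[k] w') : ∃ c : k, v = c • v' := by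
  obtain ⟨φ, hφ⟩ : ∃ φ : W →ₗ[k] k, φ w' ≠ 0 := by
    by_contra! h
    exact hw' ((Module.forall_dual_apply_eq_zero_iff k w').1 h)
  have h1 := congrArg (contractSnd φ) h
  rw [contractSnd_tmul, contractSnd_tmul] at h1
  have h2 : φ w ≠ 0 := by
    intro h0
    rw [h0, zero_smul, eq_comm, smul_eq_zero] at h1
    exact h1.elim hφ hv'
  exact ⟨(φ w)⁻¹ * φ w', by rw [mul_smul, ← h1, inv_smul_smul₀ h2]⟩

/-- Distinct nonzero vectors that are group-like for some linear map `D : V → V ⊗ V` are linearly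
independent. -/
theorem linearIndependent_of_apply_eq_tmul_self {ι : Type*} {v : ι → V} (D : V →ₗ[k] V ⊗[k] V)
    (hD : ∀ i, D (v i) = v i ⊗ₜ[k] v i) (hinj : Function.Injective v) (h0 : ∀ i, v i ≠ 0) :
    LinearIndependent k v := by
  classical
  rw [← linearIndepOn_univ_iff, linearIndepOn_iff_linearIndepOn_finset]
  rintro s -
  induction s using Finset.induction_on with
  | empty => simp
  | insert a s ha ih =>
    rw [Finset.coe_insert]
    refine ih.insert fun hmem => ?_
    obtain ⟨c, hc⟩ := Submodule.mem_span_image_finset_iff_exists_fun k |>.1 hmem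
    -- Apply (id ⊗ φ) ∘ D to v a = ∑ c i • v i and subtract φ (v a) times the same relation: ∑ c i
    -- φ(v i - v a) • v i = 0.
    have hφ : ∀ (φ : V →ₗ[k] k) (i : s), c i * φ (v i - v a) = 0 := by
      intro φ
      refine Fintype.linearIndependent_iff.1 ih _ ?_
      have h1 := congrArg (contractSnd φ ∘ₗ D) hc
      simp only [LinearMap.comp_apply, map_sum, map_smul, hD, contractSnd_tmul] at h1
      rw [← sub_eq_zero] at h1
      nth_rewrite 2 [← hc] at h1
      rw [Finset.smul_sum, ← Finset.sum_sub_distrib] at h1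
      rw [← h1]
      refine Finset.sum_congr rfl fun i _ => ?_
      rw [smul_smul, smul_smul, ← sub_smul, map_sub]
      congr 1
      ring
    have hc0 : ∀ i, c i = 0 := by
      intro i
      by_contra hci
      have : v i - v a = 0 := (Module.forall_dual_apply_eq_zero_iff k _).1 fun φ =>
        (mul_eq_zero.1 (hφ φ i)).resolve_left hci
      exact ha (hinj (sub_eq_zero.1 this) ▸ i.2)
    refine h0 a ?_
    rw [← hc]
    exact Finset.sum_eq_zero fun i _ => by rw [hc0 i, zero_smul]

end TensorSquare

/-! ### Hopf quotients of a smash coproduct. -/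

namespace SmashCoproduct

variable {k Γ H : Type*} [Field k] [Group Γ] [Group H] [Fintype H] [DecidableEq H]
  [MulDistribMulAction H Γ] {A : Type*} [Ring A] [HopfAlgebra k A]
  (f : SmashCoproduct k Γ H →ₐc[k] A)

theorem map_elt_mul_map_elt (r s : Γ) (x : H) :
    f (elt k r x) * f (elt k s x) = f (elt k (r * s) x) := by
  rw [← map_mul, elt_mul_elt, if_pos rfl]

theorem map_elt_mul_map_elt_of_ne (r s : Γ) {x y : H} (h : x ≠ y) :
    f (elt k r x) * f (elt k s y) = 0 := by
  rw [← map_mul, elt_mul_elt, if_neg h, map_zero]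

theorem comul_map_elt (r : Γ) (x : H) : Coalgebra.comul (R := k) (f (elt k r x)) =
    ∑ l : H, f (elt k r l) ⊗ₜ[k] f (elt k (l⁻¹ • r) (l⁻¹ * x)) := by
  rw [← CoalgHomClass.map_comp_comul_apply]
  change TensorProduct.map _ _ (comulMap k Γ H _) = _
  simp

theorem counit_map_elt (r : Γ) (x : H) :
    Coalgebra.counit (R := k) (f (elt k r x)) = if x = 1 then 1 else 0 := by
  rw [CoalgHomClass.counit_comp_apply]
  exact counitMap_elt k r x

/-- The component `A e_{lm} → A e_l ⊗ A e_m` of the comultiplication of `A`, where `e_x` is the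
image of `1 # δ_x`. -/
noncomputable def comulComponent (l m : H) : A →ₗ[k] A ⊗[k] A :=
  LinearMap.mulRight k (f (elt k 1 l) ⊗ₜ[k] f (elt k 1 m)) ∘ₗ Coalgebra.comul

/-- Multiplying by e_l ⊗ e_m kills every term of the comultiplication except the one indexed by l.
-/
theorem comulComponent_map_elt (l m : H) (r : Γ) : comulComponent f l m (f (elt k r (l * m))) =
    f (elt k r l) ⊗ₜ[k] f (elt k (l⁻¹ • r) m) := by
  rw [comulComponent, LinearMap.comp_apply, comul_map_elt, LinearMap.mulRight_apply,
    Finset.sum_mul, Finset.sum_eq_single l]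
  · rw [Algebra.TensorProduct.tmul_mul_tmul, inv_mul_cancel_left, map_elt_mul_map_elt,
      map_elt_mul_map_elt, mul_one, mul_one]
  · intro b _ hb
    rw [Algebra.TensorProduct.tmul_mul_tmul, map_elt_mul_map_elt_of_ne f _ _ hb,
      TensorProduct.zero_tmul]
  · simp

theorem comulComponent_map_elt_of_ne {l m x : H} (hx : x ≠ l * m) (r : Γ) :
    comulComponent f l m (f (elt k r x)) = 0 := by
  rw [comulComponent, LinearMap.comp_apply, comul_map_elt, LinearMap.mulRight_apply,
    Finset.sum_mul]
  refine Finset.sum_eq_zero fun b _ => ?_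
  rw [Algebra.TensorProduct.tmul_mul_tmul]
  by_cases hb : b = l
  · rw [map_elt_mul_map_elt_of_ne f (b⁻¹ • r), TensorProduct.tmul_zero]
    rintro rfl
    exact hx (by rw [hb, mul_inv_cancel_left])
  · rw [map_elt_mul_map_elt_of_ne f _ _ hb, TensorProduct.zero_tmul]

/-- In the corner with unit e_x this element is invertible, with inverse the image of r⁻¹ # δ_x. -/
theorem map_elt_ne_zero (r : Γ) {x : H} (h : f (elt k (1 : Γ) x) ≠ 0) : f (elt k r x) ≠ 0 := by
  intro h0
  apply h
  rw [← mul_inv_cancel r, ← map_elt_mul_map_elt, h0, zero_mul]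

theorem span_range_map_elt (hf : Function.Surjective f) :
    Submodule.span k (Set.range fun p : Γ × H => f (elt k p.1 p.2)) = ⊤ := by
  have h1 : (Set.range fun p : Γ × H => f (elt k p.1 p.2)) =
      (f : SmashCoproduct k Γ H →ₗ[k] A) '' Set.range (basis k Γ H) := by
    rw [← Set.range_comp]
    congr 1
    ext p
    simp
  rw [h1, Submodule.span_image, (basis k Γ H).span_eq, Submodule.map_top,
    LinearMap.range_eq_top]
  exact hf

/-- The elements `x` of `H` such that `1 # δ_x` has nonzero image. -/
def supportSubmonoid : Submonoid H where
  carrier := {x | f (elt k (1 : Γ) x) ≠ 0}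
  one_mem' h := by
    have := counit_map_elt f (1 : Γ) (1 : H)
    rw [h, map_zero, if_pos rfl] at this
    exact zero_ne_one this
  mul_mem' {x y} hx hy h := by
    have h1 := comulComponent_map_elt f x y (1 : Γ)
    rw [h, map_zero, smul_one] at h1
    exact tmul_ne_zero_of_ne_zero hx hy h1.symm

theorem mem_supportSubmonoid {x : H} :
    x ∈ supportSubmonoid f ↔ f (elt k (1 : Γ) x) ≠ 0 := Iff.rfl

/-- If `1 # δ_x` has zero image for every `x ≠ 1`, then `A`, being a quotient of `k[Γ]`, is
cocommutative. -/
theorem isCocomm_of_supportSubmonoid_eq_bot (hf : Function.Surjective f)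
    (h : supportSubmonoid f = ⊥) : Coalgebra.IsCocomm k A := by
  have h0 : ∀ (r : Γ) (x : H), x ≠ 1 → f (elt k r x) = 0 := by
    intro r x hx
    have : f (elt k (1 : Γ) x) = 0 := by
      by_contra h1
      rw [← ne_eq, ← mem_supportSubmonoid, h, Submonoid.mem_bot] at h1
      exact hx h1
    rw [← mul_one r, ← map_elt_mul_map_elt, this, mul_zero]
  refine ⟨LinearMap.ext_on_range (span_range_map_elt f hf) fun p => ?_⟩
  obtain ⟨r, x⟩ := p
  simp only [LinearMap.comp_apply, LinearEquiv.coe_coe]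
  by_cases hx : x = 1
  · subst hx
    rw [comul_map_elt, Finset.sum_eq_single 1]
    · simp
    · intro b _ hb
      rw [h0 _ _ hb, TensorProduct.zero_tmul]
    · simp
  · rw [h0 r x hx, map_zero, map_zero]

/-- The elements `r` of `Γ` such that `r # δ_1` and `1 # δ_1` have the same image. -/
def trivialSubgroup : Subgroup Γ where
  carrier := {r | f (elt k r (1 : H)) = f (elt k 1 1)}
  one_mem' := rfl
  mul_mem' {r s} hr hs := by
    rw [Set.mem_ofPred_eq] at hr hs ⊢
    rw [← map_elt_mul_map_elt, hr, hs, map_elt_mul_map_elt, mul_one]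
  inv_mem' {r} hr := by
    rw [Set.mem_ofPred_eq] at hr ⊢
    rw [← one_mul r⁻¹, ← map_elt_mul_map_elt, ← hr, map_elt_mul_map_elt, mul_inv_cancel, hr]

theorem mem_trivialSubgroup {r : Γ} :
    r ∈ trivialSubgroup f ↔ f (elt k r (1 : H)) = f (elt k 1 1) := Iff.rfl

instance trivialSubgroup_normal : (trivialSubgroup f).Normal where
  conj_mem r hr s := by
    rw [mem_trivialSubgroup] at hr ⊢
    rw [← map_elt_mul_map_elt, ← map_elt_mul_map_elt, hr, map_elt_mul_map_elt, mul_one,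
      map_elt_mul_map_elt, mul_inv_cancel]

/-- The (x, x⁻¹) component of f(r # δ_1) = e_1 is both f(r # δ_x) ⊗ f(x⁻¹ • r # δ_{x⁻¹}) and e_x ⊗
e_{x⁻¹}; compare first factors. -/
theorem exists_map_elt_eq_smul (hS : supportSubmonoid f = ⊤) {r : Γ}
    (hr : r ∈ trivialSubgroup f) (x : H) : ∃ c : k, f (elt k r x) = c • f (elt k 1 x) := by
  have h0 : ∀ y : H, f (elt k (1 : Γ) y) ≠ 0 := fun y =>
    (mem_supportSubmonoid f).1 (hS ▸ Submonoid.mem_top y)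
  have h1 := comulComponent_map_elt f x x⁻¹ r
  rw [mul_inv_cancel, (mem_trivialSubgroup f).1 hr] at h1
  have h2 := comulComponent_map_elt f x x⁻¹ (1 : Γ)
  rw [mul_inv_cancel, smul_one] at h2
  exact exists_eq_smul_of_tmul_eq_tmul (h0 x) (h0 x⁻¹) (h1.symm.trans h2)

/-- Since f(r # δ_{x⁻¹}) is a multiple of e_{x⁻¹}, its (x⁻¹, 1) component equals both f(r # δ_{x⁻¹})
⊗ f(x • r # δ_1) and f(r # δ_{x⁻¹}) ⊗ e_1; cancel the nonzero first factor. -/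
theorem smul_mem_trivialSubgroup (hS : supportSubmonoid f = ⊤) {r : Γ}
    (hr : r ∈ trivialSubgroup f) (x : H) : x • r ∈ trivialSubgroup f := by
  have h0 : ∀ y : H, f (elt k (1 : Γ) y) ≠ 0 := fun y =>
    (mem_supportSubmonoid f).1 (hS ▸ Submonoid.mem_top y)
  obtain ⟨c, hc⟩ := exists_map_elt_eq_smul f hS hr x⁻¹
  have h1 := comulComponent_map_elt f x⁻¹ 1 r
  have h2 := comulComponent_map_elt f x⁻¹ 1 (1 : Γ)
  rw [mul_one, inv_inv] at h1
  rw [mul_one, smul_one] at h2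
  rw [hc, map_smul, h2, TensorProduct.smul_tmul', ← hc, eq_comm, ← sub_eq_zero,
    ← TensorProduct.tmul_sub] at h1
  rw [mem_trivialSubgroup, ← sub_eq_zero]
  by_contra h3
  exact tmul_ne_zero_of_ne_zero (map_elt_ne_zero f r (h0 x⁻¹)) h3 h1

/-- Up to scalars, f(r # δ_x) depends only on x and the coset of r, so coset representatives give a
finite spanning set. -/
theorem finite_of_finite_quotient_trivialSubgroup (hf : Function.Surjective f)
    (hS : supportSubmonoid f = ⊤) [Finite (Γ ⧸ trivialSubgroup f)] : Module.Finite k A := by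
  let b : (Γ ⧸ trivialSubgroup f) × H → A := fun p => f (elt k p.1.out p.2)
  refine ⟨Submodule.fg_def.2 ⟨Set.range b, Set.finite_range b, ?_⟩⟩
  rw [eq_top_iff, ← span_range_map_elt f hf, Submodule.span_le]
  rintro _ ⟨⟨r, x⟩, rfl⟩
  have hr : (r : Γ ⧸ trivialSubgroup f).out⁻¹ * r ∈ trivialSubgroup f :=
    QuotientGroup.eq.1 (Quotient.out_eq' _)
  obtain ⟨c, hc⟩ := exists_map_elt_eq_smul f hS hr x
  have : f (elt k r x) = c • b (r, x) := by
    have h1 := map_elt_mul_map_elt f (r : Γ ⧸ trivialSubgroup f).out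
      ((r : Γ ⧸ trivialSubgroup f).out⁻¹ * r) x
    rw [mul_inv_cancel_left, hc, mul_smul_comm, map_elt_mul_map_elt, mul_one] at h1
    exact h1.symm
  change f (elt k r x) ∈ _
  rw [this]
  exact Submodule.smul_mem _ _ (Submodule.subset_span ⟨_, rfl⟩)

theorem injective_of_trivialSubgroup_eq_bot (hS : supportSubmonoid f = ⊤)
    (hT : trivialSubgroup f = ⊥) : Function.Injective f := by
  classical
  have h0 : ∀ y : H, f (elt k (1 : Γ) y) ≠ 0 := fun y =>
    (mem_supportSubmonoid f).1 (hS ▸ Submonoid.mem_top y)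
  have hli : LinearIndependent k fun r : Γ => f (elt k r (1 : H)) := by
    refine linearIndependent_of_apply_eq_tmul_self (comulComponent f 1 1) (fun r => ?_) ?_
      fun r => map_elt_ne_zero f r (h0 1)
    · have := comulComponent_map_elt f 1 1 r
      rwa [mul_one, inv_one, one_smul] at this
    · intro r s hrs
      have : r * s⁻¹ ∈ trivialSubgroup f := by
        rw [mem_trivialSubgroup, ← map_elt_mul_map_elt]
        change f (elt k r 1) = f (elt k s 1) at hrs
        rw [hrs, map_elt_mul_map_elt, mul_inv_cancel]
      rw [hT, Subgroup.mem_bot] at this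
      exact mul_inv_eq_one.1 this
  rw [injective_iff_map_eq_zero]
  intro a ha
  rw [← (basis k Γ H).repr.map_eq_zero_iff]
  ext ⟨r, x⟩
  obtain ⟨φ, hφ⟩ : ∃ φ : A →ₗ[k] k, φ (f (elt k r x)) ≠ 0 := by
    by_contra! h
    exact map_elt_ne_zero f r (h0 x) ((Module.forall_dual_apply_eq_zero_iff k _).1 h)
  obtain ⟨ψ, hψ⟩ := LinearMap.exists_extend (Finsupp.lapply r ∘ₗ hli.repr)
  have hψ' : ∀ s : Γ, ψ (f (elt k s (1 : H))) = if s = r then 1 else 0 := by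
    intro s
    have h1 := LinearMap.congr_fun hψ ⟨f (elt k s (1 : H)), Submodule.subset_span ⟨s, rfl⟩⟩
    simp only [LinearMap.comp_apply, Submodule.subtype_apply,
      Finsupp.lapply_apply] at h1
    rw [h1, hli.repr_eq_single s _ rfl, Finsupp.single_apply]
  -- The (1, x) component carries f(s # δ_x) to f(s # δ_1) ⊗ f(s # δ_x). As ψ detects s = r on the
  -- first factor, the (r, x) coordinate, up to a nonzero scalar, factors through f.
  have key : (ψ ∘ₗ contractSnd φ ∘ₗ comulComponent f 1 x) ∘ₗ (f : SmashCoproduct k Γ H →ₗ[k] A) =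
      φ (f (elt k r x)) • (basis k Γ H).coord (r, x) := by
    refine (basis k Γ H).ext fun ⟨s, y⟩ => ?_
    rw [LinearMap.smul_apply, Module.Basis.coord_apply, Module.Basis.repr_self,
      Finsupp.single_apply, basis_apply]
    change ψ (contractSnd φ (comulComponent f 1 x (f (elt k s y)))) = _
    by_cases hy : y = x
    · subst hy
      have h1 := comulComponent_map_elt f 1 y s
      rw [one_mul] at h1
      rw [h1, contractSnd_tmul, map_smul, hψ', inv_one, one_smul]
      by_cases hs : s = r
      · simp [hs]
      · simp [hs]
    · rw [comulComponent_map_elt_of_ne f (by rwa [one_mul])]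
      simp [hy]
  have h2 := LinearMap.congr_fun key a
  change ψ (contractSnd φ (comulComponent f 1 x (f a))) = _ at h2
  rw [ha, map_zero, map_zero, map_zero, LinearMap.smul_apply, Module.Basis.coord_apply,
    smul_eq_mul, eq_comm, mul_eq_zero] at h2
  exact h2.resolve_left hφ

end SmashCoproduct

/-! ### Cyclic modules over the cyclotomic integers. -/

section CyclotomicModule

open Polynomial

/-- An integral polynomial not divisible by the `p`-th cyclotomic polynomial generates together
with it an ideal that contains a nonzero integer. -/
theorem exists_mul_cyclotomic_add_mul_eq_C {p : ℕ} (hp : 0 < p) {P : ℤ[X]}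
    (hP : ¬ cyclotomic p ℤ ∣ P) :
    ∃ (a b : ℤ[X]) (n : ℤ), n ≠ 0 ∧ a * cyclotomic p ℤ + b * P = C n := by
  have hndvd : ¬ cyclotomic p ℚ ∣ P.map (Int.castRingHom ℚ) := by
    rw [← map_cyclotomic_int p ℚ]
    exact fun h => hP <|
      (cyclotomic.isPrimitive p ℤ).dvd_of_fraction_map_dvd_fraction_map h
  obtain ⟨a, b, hab⟩ := (cyclotomic.irreducible_rat hp).coprime_iff_not_dvd.2 hndvd
  -- Clear the denominators of the Bézout coefficients over ℚ.
  obtain ⟨m, hm, ha⟩ := IsLocalization.integerNormalization_spec (nonZeroDivisors ℤ) a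
  obtain ⟨n, hn, hb⟩ := IsLocalization.integerNormalization_spec (nonZeroDivisors ℤ) b
  refine ⟨C n * IsLocalization.integerNormalization (nonZeroDivisors ℤ) a,
    C m * IsLocalization.integerNormalization (nonZeroDivisors ℤ) b, m * n,
    mul_ne_zero (nonZeroDivisors.ne_zero hm) (nonZeroDivisors.ne_zero hn), ?_⟩
  apply Polynomial.map_injective (Int.castRingHom ℚ) Int.cast_injective
  rw [algebraMap_int_eq] at ha hb
  simp only [Polynomial.map_add, Polynomial.map_mul, map_C, ha, hb, map_cyclotomic]
  have h1 := congrArg (C ((m : ℚ) * n) * ·) hab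
  simp only [mul_one] at h1
  rw [zsmul_eq_mul, zsmul_eq_mul, eq_intCast, eq_intCast, eq_intCast, Int.cast_mul, ← h1, C_mul,
    C_eq_intCast, C_eq_intCast]
  ring

variable {T : Type*} [AddCommGroup T]

/-- Since Φ_p(φ) kills τ, writing u = P(φ) τ ≠ 0 forces Φ_p ∤ P. A combination of P and Φ_p equal to
n ≠ 0 then puts n τ in L, and τ generates T. -/
theorem exists_zsmul_mem_of_cyclic (φ : Module.End ℤ T) {τ : T}
    (hgen : ∀ t, ∃ P : ℤ[X], aeval φ P τ = t) {p : ℕ} [Fact p.Prime]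
    (hnorm : ∑ i ∈ Finset.range p, (φ ^ i) τ = 0) (L : Submodule ℤ T)
    (hL : ∀ t ∈ L, φ t ∈ L) {u : T} (hu : u ∈ L) (hu0 : u ≠ 0) :
    ∃ n : ℤ, n ≠ 0 ∧ ∀ t, n • t ∈ L := by
  have hLP : ∀ (P : ℤ[X]) (t : T), t ∈ L → aeval φ P t ∈ L := by
    intro P t ht
    induction P using Polynomial.induction_on' generalizing t with
    | add P Q hP hQ => rw [map_add]; exact L.add_mem (hP t ht) (hQ t ht)
    | monomial i a =>
      have : ∀ i : ℕ, (φ ^ i) t ∈ L := by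
        intro i
        induction i with
        | zero => simpa using ht
        | succ i ih => rw [pow_succ']; exact hL _ ih
      rw [aeval_monomial, Module.End.mul_apply, Module.algebraMap_end_apply]
      exact L.smul_mem a (this i)
  have hΦ : aeval φ (cyclotomic p ℤ) τ = 0 := by
    rw [cyclotomic_prime, map_sum, ← hnorm, LinearMap.sum_apply]
    simp
  obtain ⟨P, rfl⟩ := hgen u
  have hP : ¬ cyclotomic p ℤ ∣ P := by
    rintro ⟨Q, rfl⟩
    apply hu0
    rw [mul_comm, map_mul, Module.End.mul_apply, hΦ, map_zero]
  obtain ⟨a, b, n, hn, hab⟩ :=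
    exists_mul_cyclotomic_add_mul_eq_C (Fact.out : p.Prime).pos hP
  have hnτ : n • τ ∈ L := by
    have h1 := congrArg (fun Q => aeval φ Q τ) hab
    simp only [map_add, map_mul, LinearMap.add_apply, Module.End.mul_apply, hΦ, map_zero,
      zero_add, aeval_C, Module.algebraMap_end_apply] at h1
    rw [← h1]
    exact hLP b _ hu
  refine ⟨n, hn, fun t => ?_⟩
  obtain ⟨Q, rfl⟩ := hgen t
  rw [← map_zsmul]
  exact hLP Q _ hnτ

end CyclotomicModule

/-- Let `T` be a commutative subgroup stable under `φ`, generated by the `φ`-orbit of an element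
`τ` killed by `1 + φ + ⋯ + φ^(p-1)`. If a subgroup `L` meets `T` nontrivially and `L ⊓ T` is
`φ`-stable, then `T / (L ⊓ T)` has finite exponent. -/
theorem Subgroup.exists_zpow_mem_of_cyclic {G : Type*} [Group G] (T L : Subgroup G)
    (hT : ∀ a ∈ T, ∀ b ∈ T, a * b = b * a) (φ : G →* G) (hφT : ∀ t ∈ T, φ t ∈ T) {τ : G}
    (hτ : τ ∈ T) (hgen : T ≤ Subgroup.closure (Set.range fun j : ℕ => φ^[j] τ)) {p : ℕ}
    [Fact p.Prime] (hnorm : ((List.range p).map fun j => φ^[j] τ).prod = 1)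
    (hL : ∀ t ∈ T, t ∈ L → φ t ∈ L) {u : G} (huT : u ∈ T) (huL : u ∈ L) (hu : u ≠ 1) :
    ∃ n : ℤ, n ≠ 0 ∧ ∀ t ∈ T, t ^ n ∈ L := by
  let _ : CommGroup T := { (inferInstance : Group T) with
    mul_comm := fun a b => Subtype.ext (hT a a.2 b b.2) }
  let φT : T →* T := (φ.comp T.subtype).codRestrict T fun t => hφT t t.2
  let Φ : Module.End ℤ (Additive T) := (MonoidHom.toAdditive φT).toIntLinearMap
  let τ' : Additive T := Additive.ofMul ⟨τ, hτ⟩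
  let L' : Submodule ℤ (Additive T) := AddSubgroup.toIntSubmodule (L.subgroupOf T).toAddSubgroup
  have hpow : ∀ j : ℕ, ((((Φ ^ j) τ').toMul : T) : G) = φ^[j] τ := by
    intro j
    induction j with
    | zero => rfl
    | succ j ih => rw [pow_succ', Function.iterate_succ_apply', ← ih]; rfl
  have hsum : ∀ m : ℕ, (((∑ i ∈ Finset.range m, (Φ ^ i) τ').toMul : T) : G) =
      ((List.range m).map fun j => φ^[j] τ).prod := by
    intro m
    induction m with
    | zero => rfl
    | succ m ih =>
      rw [Finset.sum_range_succ, List.range_succ, List.map_append, List.prod_append, ← ih,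
        toMul_add, Subgroup.coe_mul, hpow]
      simp
  have key := exists_zsmul_mem_of_cyclic Φ (τ := τ') ?_ (p := p) ?_ L' ?_
    (u := Additive.ofMul ⟨u, huT⟩) huL ?_
  · obtain ⟨n, hn, h⟩ := key
    exact ⟨n, hn, fun t ht => h (Additive.ofMul ⟨t, ht⟩)⟩
  · rintro t
    have : ∀ g ∈ Subgroup.closure (Set.range fun j : ℕ => φ^[j] τ),
        ∃ P : Polynomial ℤ, (((Polynomial.aeval Φ P τ').toMul : T) : G) = g := by
      intro g hg
      induction hg using Subgroup.closure_induction with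
      | mem g hg =>
        obtain ⟨j, rfl⟩ := hg
        exact ⟨Polynomial.X ^ j, by simpa using hpow j⟩
      | one => exact ⟨0, by simp⟩
      | mul g h _ _ hg hh =>
        obtain ⟨P, rfl⟩ := hg
        obtain ⟨Q, rfl⟩ := hh
        exact ⟨P + Q, by simp⟩
      | inv g _ hg =>
        obtain ⟨P, rfl⟩ := hg
        exact ⟨-P, by simp⟩
    obtain ⟨P, hP⟩ := this t.toMul (hgen t.toMul.2)
    exact ⟨P, Additive.toMul.injective (Subtype.ext hP)⟩
  · exact Additive.toMul.injective (Subtype.ext ((hsum p).trans hnorm))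
  · exact fun t ht => hL _ t.toMul.2 ht
  · exact fun h => hu (congrArg (fun t : Additive T => ((t.toMul : T) : G)) h)

/-! ### The translation subgroup and the normal subgroups of Γ_{M,N}. -/

namespace GammaGroup

variable (M N : ℕ)

theorem gen_pow (i : ZMod M) : gen M N i ^ N = 1 := by
  have := PresentedGroup.one_of_mem (rels := gammaRels M N) (Or.inl ⟨i, rfl⟩)
  rwa [map_pow] at this

/-- The product `g_{i_1} ⋯ g_{i_n}`. -/
def word (l : List (ZMod M)) : GammaGroup M N := (l.map (gen M N)).prod

theorem word_append (l l' : List (ZMod M)) :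
    word M N (l ++ l') = word M N l * word M N l' := by
  simp [word]

theorem word_cons (i : ZMod M) (l : List (ZMod M)) :
    word M N (i :: l) = gen M N i * word M N l := by
  simp [word]

theorem word_replicate (n : ℕ) (i : ZMod M) : word M N (List.replicate n i) = gen M N i ^ n := by
  simp [word]

theorem word_comm {l l' : List (ZMod M)} (hl : l.length = N) (hl' : l'.length = N) :
    word M N l * word M N l' = word M N l' * word M N l := by
  have := PresentedGroup.one_of_mem (rels := gammaRels M N)
    (Or.inr ⟨fun t => l.get (t.cast hl.symm), fun t => l'.get (t.cast hl'.symm), rfl⟩)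
  have hofFn : ∀ {m : List (ZMod M)} (hm : m.length = N),
      (List.ofFn fun t => FreeGroup.of (m.get (t.cast hm.symm))) = m.map FreeGroup.of := by
    intro m hm
    refine List.ext_getElem (by simp [hm]) fun n _ _ => ?_
    simp
  rw [hofFn hl, hofFn hl', map_commutatorElement, commutatorElement_eq_one_iff_mul_comm,
    map_list_prod, map_list_prod, List.map_map, List.map_map] at this
  exact this

/-- The subgroup of `Γ_{M,N}` generated by the words of length `N`. -/
def translations : Subgroup (GammaGroup M N) :=
  Subgroup.closure {w | ∃ l : List (ZMod M), l.length = N ∧ word M N l = w}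

theorem word_mem_translations {l : List (ZMod M)} (hl : N ∣ l.length) :
    word M N l ∈ translations M N := by
  obtain ⟨c, hc⟩ := hl
  induction c generalizing l with
  | zero =>
    rw [mul_zero, List.length_eq_zero_iff] at hc
    subst hc
    exact one_mem _
  | succ c ih =>
    rw [← List.take_append_drop N l, word_append]
    refine mul_mem (Subgroup.subset_closure ⟨_, ?_, rfl⟩) (ih ?_)
    · rw [List.length_take, hc]
      exact min_eq_left (Nat.le_mul_of_pos_right N c.succ_pos)
    · rw [List.length_drop, hc, mul_add, mul_one, Nat.add_sub_cancel]

theorem translations_comm (a : GammaGroup M N) (ha : a ∈ translations M N) (b : GammaGroup M N)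
    (hb : b ∈ translations M N) : a * b = b * a := by
  have : IsMulCommutative (translations M N) := Subgroup.isMulCommutative_closure (by
    rintro _ ⟨l, hl, rfl⟩ _ ⟨l', hl', rfl⟩
    exact word_comm M N hl hl')
  exact setLike_mul_comm ha hb

theorem closure_range_gen : Subgroup.closure (Set.range (gen M N)) = ⊤ :=
  PresentedGroup.closure_range_of (gammaRels M N)

theorem translations_fg [NeZero M] : (translations M N).FG := by
  rw [Subgroup.fg_iff]
  exact ⟨_, rfl, ((List.finite_length_eq (ZMod M) N).image (word M N)).subset
    (by rintro _ ⟨l, hl, rfl⟩; exact ⟨l, hl, rfl⟩)⟩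

theorem smul_mem_translations (a : Multiplicative (ZMod M)) {t : GammaGroup M N}
    (ht : t ∈ translations M N) : a • t ∈ translations M N := by
  induction ht using Subgroup.closure_induction with
  | mem t ht =>
    obtain ⟨l, hl, rfl⟩ := ht
    have : a • word M N l = word M N (l.map fun i => i + a.toAdd) := by
      clear hl
      induction l with
      | nil => exact smul_one a
      | cons i l ih => rw [word_cons, smul_mul', ih, smul_gen, List.map_cons, word_cons]
    rw [this]
    exact word_mem_translations M N (by simp [hl])
  | one => rw [smul_one]; exact one_mem _
  | mul x y _ _ hx hy => rw [smul_mul']; exact mul_mem hx hy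
  | inv x _ hx => rw [smul_inv']; exact inv_mem hx

section

variable [NeZero N]

/-- Inverses become positive words, so membership in the translation subgroup can be read off from
lengths modulo N. -/
theorem gen_inv (i : ZMod M) : (gen M N i)⁻¹ = word M N (List.replicate (N - 1) i) := by
  rw [word_replicate, inv_eq_iff_mul_eq_one, mul_pow_sub_one (NeZero.ne N), gen_pow]

theorem gen_mul_gen_inv_mem_translations (i j : ZMod M) :
    gen M N i * (gen M N j)⁻¹ ∈ translations M N := by
  rw [gen_inv, ← word_cons]
  refine word_mem_translations M N ?_
  rw [List.length_cons, List.length_replicate, Nat.sub_add_cancel (NeZero.pos N)]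

instance translations_normal : (translations M N).Normal := by
  -- Conjugating a word of length N this way gives a word of length 2N. It is used for both g_i and
  -- g_i⁻¹.
  have key : ∀ (l l' : List (ZMod M)), l.length + l'.length = N →
      (word M N l)⁻¹ = word M N l' → ∀ t ∈ translations M N,
      word M N l * t * (word M N l)⁻¹ ∈ translations M N := by
    intro l l' hll' hinv t ht
    induction ht using Subgroup.closure_induction with
    | mem t ht =>
      obtain ⟨m, hm, rfl⟩ := ht
      rw [hinv, ← word_append, ← word_append]
      refine word_mem_translations M N ⟨2, ?_⟩
      simp only [List.length_append]
      omega
    | one => simp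
    | mul a b _ _ ha hb =>
      have := mul_mem ha hb
      rwa [conj_mul] at this
    | inv a _ ha =>
      have := inv_mem ha
      rwa [conj_inv] at this
  have hN := NeZero.pos N
  have hgen : ∀ i, word M N [i] = gen M N i := fun i => by simp [word]
  refine ⟨fun t ht g => ?_⟩
  have hg : g ∈ Subgroup.closure (Set.range (gen M N)) := by
    rw [closure_range_gen]
    trivial
  induction hg using Subgroup.closure_induction'' generalizing t with
  | mem g hg =>
    obtain ⟨i, rfl⟩ := hg
    rw [← hgen]
    refine key [i] (List.replicate (N - 1) i) ?_ (by rw [hgen, gen_inv]) t ht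
    simp only [List.length_singleton, List.length_replicate]
    omega
  | inv_mem g hg =>
    obtain ⟨i, rfl⟩ := hg
    rw [gen_inv]
    refine key (List.replicate (N - 1) i) [i] ?_ (by rw [← gen_inv, hgen, inv_inv]) t ht
    simp only [List.length_singleton, List.length_replicate]
    omega
  | one => simpa using ht
  | mul x y _ _ hx hy =>
    have := hx _ (hy t ht)
    simpa only [mul_inv_rev, mul_assoc] using this

theorem translations_sup_zpowers :
    translations M N ⊔ Subgroup.zpowers (gen M N 0) = ⊤ := by
  rw [eq_top_iff, ← closure_range_gen, Subgroup.closure_le]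
  rintro _ ⟨i, rfl⟩
  rw [← inv_mul_cancel_right (gen M N i) (gen M N 0)]
  exact mul_mem (Subgroup.mem_sup_left (gen_mul_gen_inv_mem_translations M N i 0))
    (Subgroup.mem_sup_right (Subgroup.mem_zpowers _))

theorem exists_eq_translation_mul_zpow (g : GammaGroup M N) :
    ∃ t ∈ translations M N, ∃ c : ℤ, t * gen M N 0 ^ c = g := by
  have hg : g ∈ translations M N ⊔ Subgroup.zpowers (gen M N 0) := by
    rw [translations_sup_zpowers]; trivial
  obtain ⟨t, ht, _, ⟨c, rfl⟩, h⟩ := Subgroup.mem_sup_of_normal_left.1 hg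
  exact ⟨t, ht, c, h⟩

/-- The quotient is the product of the image of T, a finitely generated torsion abelian group, and a
finite cyclic group generated by the image of g_0. -/
theorem finite_quotient_of_zpow_mem [NeZero M] (L : Subgroup (GammaGroup M N)) [L.Normal] {n : ℤ}
    (hn : n ≠ 0) (h : ∀ t ∈ translations M N, t ^ n ∈ L) : Finite (GammaGroup M N ⧸ L) := by
  let π := QuotientGroup.mk' L
  let T' := (translations M N).map π
  let _ : CommGroup T' := { (inferInstance : Group T') with
    mul_comm := by
      rintro ⟨_, a, ha, rfl⟩ ⟨_, b, hb, rfl⟩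
      refine Subtype.ext ?_
      change π a * π b = π b * π a
      rw [← map_mul, translations_comm M N a ha b hb, map_mul] }
  have hfg : Group.FG T' := (Group.fg_iff_subgroup_fg T').2 (by
    obtain ⟨S, hS⟩ := translations_fg M N
    classical
    exact ⟨S.image π, by rw [Finset.coe_image, ← MonoidHom.map_closure, hS]⟩)
  have htors : IsMulTorsion T' := by
    rintro ⟨_, a, ha, rfl⟩
    rw [isOfFinOrder_iff_zpow_eq_one]
    refine ⟨n, hn, Subtype.ext ?_⟩
    change π a ^ n = 1
    rw [← map_zpow]
    exact (QuotientGroup.eq_one_iff _).2 (h a ha)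
  have : Finite T' := CommGroup.finite_of_fg_isMulTorsion T' htors
  have : Finite (Subgroup.zpowers (π (gen M N 0))) := by
    rw [← SetLike.coe_sort_coe, Set.finite_coe_iff, finite_zpowers, isOfFinOrder_iff_pow_eq_one]
    exact ⟨N, NeZero.pos N, by rw [← map_pow, gen_pow, map_one]⟩
  refine Finite.of_surjective
    (fun q : T' × Subgroup.zpowers (π (gen M N 0)) => (q.1 * q.2 : GammaGroup M N ⧸ L)) ?_
  intro q
  obtain ⟨g, rfl⟩ := QuotientGroup.mk'_surjective L q
  obtain ⟨t, ht, c, rfl⟩ := exists_eq_translation_mul_zpow M N g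
  exact ⟨(⟨π t, t, ht, rfl⟩, ⟨π (gen M N 0) ^ c, c, rfl⟩), by simp [π]⟩

/-- A normal subgroup of `Γ_{M,N}` that is not contained in the translation subgroup contains the
`N`-th powers of all translations, since the quotient is commutative. -/
theorem pow_mem_of_not_le_translations (hN : N.Prime) (L : Subgroup (GammaGroup M N)) [L.Normal]
    (hL : ¬ L ≤ translations M N) (g : GammaGroup M N) : g ^ N ∈ L := by
  obtain ⟨u, huL, huT⟩ := SetLike.not_le_iff_exists.1 hL
  obtain ⟨t, ht, c, rfl⟩ := exists_eq_translation_mul_zpow M N u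
  have hc : gen M N 0 ^ c ∈ translations M N ⊔ L :=
    (Subgroup.mul_mem_cancel_left _ (Subgroup.mem_sup_left ht)).1 (Subgroup.mem_sup_right huL)
  -- If the prime N divided c, then g_0 ^ c = 1 and u = t would be a translation.
  have hcN : IsCoprime c (N : ℤ) := by
    rw [isCoprime_comm, (Nat.prime_iff_prime_int.1 hN).irreducible.coprime_iff_not_dvd]
    rintro ⟨d, rfl⟩
    apply huT
    rw [zpow_mul, zpow_natCast, gen_pow, one_zpow, mul_one]
    exact ht
  have h0 : gen M N 0 ∈ translations M N ⊔ L := by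
    obtain ⟨a, b, hab⟩ := hcN
    have h1 : gen M N 0 = (gen M N 0 ^ c) ^ a := by
      rw [← zpow_mul, mul_comm, eq_sub_of_add_eq hab, zpow_sub, mul_comm b, zpow_mul, zpow_natCast,
        gen_pow]
      simp
    rw [h1]
    exact zpow_mem hc a
  have htop : translations M N ⊔ L = ⊤ := by
    rw [eq_top_iff, ← translations_sup_zpowers, sup_le_iff, Subgroup.zpowers_le]
    exact ⟨le_sup_left, h0⟩
  let π := QuotientGroup.mk' L
  -- As T L is the whole group, every class modulo L is represented by a translation.
  have hcomm : ∀ a b, π a * π b = π b * π a := by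
    have hπ : ∀ g, ∃ t ∈ translations M N, π t = π g := by
      intro g
      obtain ⟨t, ht, x, hx, rfl⟩ :=
        Subgroup.mem_sup_of_normal_left.1 (htop ▸ Subgroup.mem_top g)
      refine ⟨t, ht, ?_⟩
      rw [map_mul, show π x = 1 from (QuotientGroup.eq_one_iff x).2 hx, mul_one]
    intro a b
    obtain ⟨s, hs, hsa⟩ := hπ a
    obtain ⟨t, ht, htb⟩ := hπ b
    rw [← hsa, ← htb, ← map_mul, translations_comm M N s hs t ht, map_mul]
  rw [← QuotientGroup.eq_one_iff]
  change π (g ^ N) = 1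
  have hg : g ∈ Subgroup.closure (Set.range (gen M N)) := by
    rw [closure_range_gen]; trivial
  rw [map_pow]
  induction hg using Subgroup.closure_induction with
  | mem g hg => obtain ⟨i, rfl⟩ := hg; rw [← map_pow, gen_pow, map_one]
  | one => rw [map_one, one_pow]
  | mul a b _ _ ha hb => rw [map_mul, (show Commute (π a) (π b) from hcomm a b).mul_pow, ha, hb,
      one_mul]
  | inv a _ ha => rw [map_inv, inv_pow, ha, inv_one]

end

theorem gen_mul_self (i : ZMod M) : gen M 2 i * gen M 2 i = 1 := by
  rw [← sq, gen_pow]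

/-- Take τ = g_0 g_1 and φ the shift by 1. Because g_i² = 1, the product of the first m iterates
telescopes to g_0 g_m, which is 1 for m = M. -/
theorem exists_zpow_mem_of_two [Fact M.Prime] (L : Subgroup (GammaGroup M 2))
    (hL : ∀ (a : Multiplicative (ZMod M)), ∀ t ∈ L, a • t ∈ L) {u : GammaGroup M 2}
    (huT : u ∈ translations M 2) (huL : u ∈ L) (hu : u ≠ 1) :
    ∃ n : ℤ, n ≠ 0 ∧ ∀ t ∈ translations M 2, t ^ n ∈ L := by
  have hiter : ∀ j : ℕ, (shift M 2 1)^[j] (gen M 2 0 * gen M 2 1) =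
      gen M 2 j * gen M 2 (j + 1 : ℕ) := by
    intro j
    induction j with
    | zero => simp
    | succ j ih => rw [Function.iterate_succ_apply', ih, map_mul, shift_gen, shift_gen]; simp
  have hprod : ∀ m : ℕ, ((List.range m).map fun j =>
      (shift M 2 1)^[j] (gen M 2 0 * gen M 2 1)).prod = gen M 2 0 * gen M 2 m := by
    intro m
    induction m with
    | zero => simp [gen_mul_self]
    | succ m ih =>
      rw [List.range_succ, List.map_append, List.prod_append, ih, List.map_singleton,
        List.prod_singleton, hiter, mul_assoc, ← mul_assoc (gen M 2 m), gen_mul_self, one_mul]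
  have hmem : ∀ i : ZMod M, gen M 2 0 * gen M 2 i ∈ Subgroup.closure
      (Set.range fun j : ℕ => (shift M 2 1)^[j] (gen M 2 0 * gen M 2 1)) := by
    intro i
    rw [← ZMod.natCast_zmod_val i, ← hprod]
    refine list_prod_mem fun x hx => ?_
    obtain ⟨j, -, rfl⟩ := List.mem_map.1 hx
    exact Subgroup.subset_closure ⟨j, rfl⟩
  refine Subgroup.exists_zpow_mem_of_cyclic (translations M 2) L (translations_comm M 2)
    (shift M 2 1) (fun t ht => smul_mem_translations M 2 (Multiplicative.ofAdd 1) ht)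
    (τ := gen M 2 0 * gen M 2 1) ?_ ?_ (p := M) ?_
    (fun t _ ht => hL (Multiplicative.ofAdd 1) t ht) huT huL hu
  · simpa [word] using word_mem_translations M 2 (l := [0, 1]) (by simp)
  · rw [translations, Subgroup.closure_le]
    rintro _ ⟨l, hl, rfl⟩
    obtain ⟨i, j, rfl⟩ := List.length_eq_two.1 hl
    -- (g_0 g_i)⁻¹ (g_0 g_j) = g_i g_j.
    have h1 := mul_mem (inv_mem (hmem i)) (hmem j)
    rw [mul_inv_rev, mul_assoc, inv_mul_cancel_left,
      inv_eq_of_mul_eq_one_left (gen_mul_self M i)] at h1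
    simpa [word] using h1
  · rw [hprod, ZMod.natCast_self, gen_mul_self]

/-- Take τ = g_1 g_0⁻¹ and φ conjugation by g_0, so that normality alone makes L stable. The first m
iterates multiply to g_1^m g_0^(-m), which is 1 for m = N. -/
theorem exists_zpow_mem_of_two_generators [Fact N.Prime] (L : Subgroup (GammaGroup 2 N))
    [L.Normal] {u : GammaGroup 2 N} (huT : u ∈ translations 2 N) (huL : u ∈ L) (hu : u ≠ 1) :
    ∃ n : ℤ, n ≠ 0 ∧ ∀ t ∈ translations 2 N, t ^ n ∈ L := by
  have : NeZero N := ⟨(Fact.out : N.Prime).ne_zero⟩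
  set g₀ := gen 2 N 0 with hg₀
  set τ := gen 2 N 1 * g₀⁻¹ with hτ
  let φ : GammaGroup 2 N →* GammaGroup 2 N := (MulAut.conj g₀).toMonoidHom
  have hφ : ∀ x, φ x = g₀ * x * g₀⁻¹ := fun _ => rfl
  have hprod : ∀ m : ℕ, ((List.range m).map fun j => φ^[j] τ).prod =
      gen 2 N 1 ^ m * (g₀ ^ m)⁻¹ := by
    have hiter : ∀ j : ℕ, φ^[j] τ = g₀ ^ j * τ * (g₀ ^ j)⁻¹ := by
      intro j
      induction j with
      | zero => simp
      | succ j ih => rw [Function.iterate_succ_apply', ih, hφ, pow_succ']; group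
    intro m
    induction m with
    | zero => simp
    | succ m ih =>
      rw [List.range_succ, List.map_append, List.prod_append, ih, List.map_singleton,
        List.prod_singleton, hiter, hτ, pow_succ, pow_succ]
      group
  set C := Subgroup.closure (Set.range fun j : ℕ => φ^[j] τ) with hC
  have hφC : ∀ x ∈ C, φ x ∈ C := by
    intro x hx
    induction hx using Subgroup.closure_induction with
    | mem x hx =>
      obtain ⟨j, rfl⟩ := hx
      exact Subgroup.subset_closure ⟨j + 1, Function.iterate_succ_apply' _ _ _⟩
    | one => rw [map_one]; exact one_mem _
    | mul x y _ _ hx hy => rw [map_mul]; exact mul_mem hx hy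
    | inv x _ hx => rw [map_inv]; exact inv_mem hx
  -- The correction by a power of g_0 lets the induction pass through all lengths; it disappears at
  -- length N.
  have hword : ∀ l : List (ZMod 2), word 2 N l * (g₀ ^ l.length)⁻¹ ∈ C := by
    intro l
    induction l with
    | nil => simp [word, one_mem]
    | cons i l ih =>
      have h1 : word 2 N (i :: l) * (g₀ ^ (i :: l).length)⁻¹ =
          gen 2 N i * g₀⁻¹ * φ (word 2 N l * (g₀ ^ l.length)⁻¹) := by
        rw [word_cons, hφ, List.length_cons, pow_succ']
        group
      rw [h1]
      refine mul_mem ?_ (hφC _ ih)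
      obtain rfl | rfl : i = 0 ∨ i = 1 := by clear h1; revert i; decide
      · rw [← hg₀, mul_inv_cancel]
        exact one_mem _
      · exact Subgroup.subset_closure ⟨0, rfl⟩
  refine Subgroup.exists_zpow_mem_of_cyclic (translations 2 N) L (translations_comm 2 N) φ
    (fun t ht => (translations_normal 2 N).conj_mem t ht g₀) (τ := τ)
    (gen_mul_gen_inv_mem_translations 2 N 1 0) ?_ (p := N) ?_
    (fun t _ ht => Subgroup.Normal.conj_mem inferInstance t ht g₀) huT huL hu
  · rw [translations, Subgroup.closure_le]
    rintro _ ⟨l, hl, rfl⟩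
    have := hword l
    rwa [hl, hg₀, gen_pow, inv_one, mul_one] at this
  · rw [hprod, gen_pow, hg₀, gen_pow, inv_one, mul_one]

/-- Nontrivial normal subgroups of `Γ_{M,N}` stable under the cyclic action have finite index. -/
theorem finite_quotient_of_ne_bot [NeZero M] (hMN : (N = 2 ∧ M.Prime) ∨ (M = 2 ∧ N.Prime))
    (L : Subgroup (GammaGroup M N)) [L.Normal]
    (hL : ∀ (a : Multiplicative (ZMod M)), ∀ t ∈ L, a • t ∈ L) (hbot : L ≠ ⊥) :
    Finite (GammaGroup M N ⧸ L) := by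
  have hN : N.Prime := by
    rcases hMN with ⟨rfl, -⟩ | ⟨-, h⟩
    · exact Nat.prime_two
    · exact h
  have : NeZero N := ⟨hN.ne_zero⟩
  suffices h : ∃ n : ℤ, n ≠ 0 ∧ ∀ t ∈ translations M N, t ^ n ∈ L by
    obtain ⟨n, hn, h⟩ := h
    exact finite_quotient_of_zpow_mem M N L hn h
  by_cases hLT : L ≤ translations M N
  · obtain ⟨u, huL, hu⟩ := L.bot_or_exists_ne_one.resolve_left hbot
    rcases hMN with ⟨rfl, hM⟩ | ⟨rfl, -⟩
    · have : Fact M.Prime := ⟨hM⟩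
      exact exists_zpow_mem_of_two M L hL (hLT huL) huL hu
    · have : Fact N.Prime := ⟨hN⟩
      exact exists_zpow_mem_of_two_generators N L (hLT huL) huL hu
  · refine ⟨N, Int.natCast_ne_zero.2 hN.ne_zero, fun t _ => ?_⟩
    rw [zpow_natCast]
    exact pow_mem_of_not_le_translations M N hN L hLT t

end GammaGroup

/-! ### The main theorem. -/

theorem theorem3p4 {k : Type*} [Field k] (M N : ℕ) [NeZero M]
    (hMN : (N = 2 ∧ M.Prime) ∨ (M = 2 ∧ N.Prime))
    {A : Type*} [Ring A] [HopfAlgebra k A]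
    (f : SmashCoproduct k (GammaGroup M N) (Multiplicative (ZMod M)) →ₐc[k] A)
    (hf : Function.Surjective f)
    (hinf : ¬ Module.Finite k A)
    (hcocomm : ¬ Coalgebra.IsCocomm k A) :
    ∃ e : SmashCoproduct k (GammaGroup M N) (Multiplicative (ZMod M)) ≃ₐc[k] A,
      ∀ x, e x = f x := by
  have hM : Fact M.Prime := ⟨by
    rcases hMN with ⟨-, h⟩ | ⟨rfl, -⟩
    · exact h
    · exact Nat.prime_two⟩
  have hS : SmashCoproduct.supportSubmonoid f = ⊤ := by
    obtain ⟨x, hx, hx1⟩ := (SmashCoproduct.supportSubmonoid f).bot_or_exists_ne_one.resolve_left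
      (mt (SmashCoproduct.isCocomm_of_supportSubmonoid_eq_bot f hf) hcocomm)
    rw [eq_top_iff]
    intro y _
    have hcard : Nat.card (Multiplicative (ZMod M)) = M := by simp
    -- In a group of prime order the powers of any nontrivial element exhaust the group.
    exact Submonoid.powers_le.2 hx (mem_powers_of_prime_card hcard hx1)
  have hT : SmashCoproduct.trivialSubgroup f = ⊥ := by
    by_contra hbot
    have := GammaGroup.finite_quotient_of_ne_bot M N hMN (SmashCoproduct.trivialSubgroup f)
      (fun a t ht => SmashCoproduct.smul_mem_trivialSubgroup f hS ht a) hbot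
    exact hinf (SmashCoproduct.finite_of_finite_quotient_trivialSubgroup f hf hS)
  exact ⟨BialgEquiv.ofBijective f ⟨SmashCoproduct.injective_of_trivialSubgroup_eq_bot f hS hT, hf⟩,
    fun _ => rfl⟩
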